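/- Let $\gamma$ be the Euler–Mascheroni constant and let $A = 1.2824271291\ldots$ be the Glaisher–Kinkelin constant, $$A=\lim_{n\to\infty}\frac{\prod_{k=1}^{n}k^{k}}{n^{\frac{n^2}{2}+\frac n2+\frac1{12}}\,e^{-n^2/4}},$$ where this limit exists and is positive. Then $$\left(3\left(\frac{2\pi e^{\gamma}}{A^{12}}\right)^{2}\right)^{\frac{\pi^2}{18}} =\prod_{k=1}^{\infty}\frac{(3k)^{\frac{1}{(3k)^2}}\cdot(3k)^{\frac{1}{(3k)^2}}}{(3k-1)^{\frac{1}{(3k-1)^2}}\cdot(3k+1)^{\frac{1}{(3k+1)^2}}} =\frac{3^{\frac{1}{3^2}}\cdot3^{\frac{1}{3^2}}}{2^{\frac{1}{2^2}}\cdot4^{\frac{1}{4^2}}}\cdot\frac{6^{\frac{1}{6^2}}\cdot6^{\frac{1}{6^2}}}{5^{\frac{1}{5^2}}\cdot7^{\frac{1}{7^2}}}\cdot\frac{9^{\frac{1}{9^2}}\cdot9^{\frac{1}{9^2}}}{8^{\frac{1}{8^2}}\cdot10^{\frac{1}{10^2}}}\cdots,$$ where the infinite product converges, as the limit of its partial products.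 -/

import Mathlib

open Filter Topology

/-- The hyperfactorial `H(n) = 1¹ · 2² · 3³ ⋯ nⁿ` (the value `K(n + 1)` of the K-function). -/
def hyperfactorial (n : ℕ) : ℕ := ∏ k ∈ Finset.Icc 1 n, k ^ k

/-- The sequence `H(n) / (n ^ (n² / 2 + n / 2 + 1 / 12) · e ^ (-n² / 4))`, whose limit is the
Glaisher–Kinkelin constant. -/
noncomputable def glaisherKinkelinSeq (n : ℕ) : ℝ :=
  (hyperfactorial n : ℝ) /
    ((n : ℝ) ^ ((n : ℝ) ^ 2 / 2 + (n : ℝ) / 2 + 1 / 12) * Real.exp (-(n : ℝ) ^ 2 / 4))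

/-- The Glaisher–Kinkelin constant `A = 1.2824271291…`. -/
noncomputable def glaisherKinkelin : ℝ := limUnder atTop glaisherKinkelinSeq

/-- The block
`((3k)^(1/(3k)²) · (3k)^(1/(3k)²)) / ((3k-1)^(1/(3k-1)²) · (3k+1)^(1/(3k+1)²))`,
meant for `k ≥ 1`; the subtraction is in `ℝ`. -/
noncomputable def wallisBlock (k : ℕ) : ℝ :=
  ((3 * k : ℝ) ^ (1 / (3 * k : ℝ) ^ 2) * (3 * k : ℝ) ^ (1 / (3 * k : ℝ) ^ 2)) /
    ((3 * k - 1 : ℝ) ^ (1 / (3 * k - 1 : ℝ) ^ 2) * (3 * k + 1 : ℝ) ^ (1 / (3 * k + 1 : ℝ) ^ 2))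

/-!
Write `L = ∑ log n / n² = -ζ'(2)`. Taking logarithms, a block contributes three times the term of
`L` with index `3k` minus the three terms with indices `3k - 1, 3k, 3k + 1`. As
`∑ log (3k) / (3k)² = (ζ(2) log 3 + L) / 9`, the logarithm of the product is
`(π² / 18) log 3 - (2 / 3) L` (`tendsto_prod_wallisBlock`), and it remains to express `L` through
the Glaisher–Kinkelin constant `A`.

For this, `log A = 1/12 - ζ'(-1)` (`tendsto_glaisherKinkelinSeq`): the Euler–Maclaurin remainders
`emTerm n s` of `∑ n ^ (-s)` are `O(n ^ (-re s - 3))`, so their sum is holomorphic beyond `s = -1`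
and continues `ζ` minus an elementary term (`eqOn_tsum_emTerm`). Differentiating term by term at
`s = -1` gives a convergent series whose partial sums are `1/4 - log (glaisherKinkelinSeq (N +
1))`; this also shows that the limit defining `A` exists. The derivative of the functional
equation at `s = 2`, with `Γ'(2) = 1 - γ`, turns `ζ'(-1)` into `(1 - γ - log 2π) / 12 - L / (2π²)`
(`deriv_riemannZeta_neg_one`).
-/

/-! ### An Euler–Maclaurin series for the zeta function -/

/-- The boundary term `f(x)/2 - F(x) - f'(x)/12` of the Euler–Maclaurin formula for
`f(x) = x ^ (-s)`, with primitive `F(x) = x ^ (1 - s) / (1 - s)`; meant for `x > 0`, `s ≠ 1`. -/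
noncomputable def emCorrection (x : ℝ) (s : ℂ) : ℂ :=
  (x : ℂ) ^ (-s) / 2 - (x : ℂ) ^ (1 - s) / (1 - s) + s * (x : ℂ) ^ (-s - 1) / 12

/-- The error of the corrected trapezoidal rule for `x ^ (-s)` on `[n + 1, n + 2]`, written as the
summand `(n + 1) ^ (-s)` plus an increment of `emCorrection`, so that its partial sums telescope. -/
noncomputable def emTerm (n : ℕ) (s : ℂ) : ℂ :=
  ((n + 1 : ℝ) : ℂ) ^ (-s) + (emCorrection (n + 2) s - emCorrection (n + 1) s)

lemma hasDerivAt_ofReal_cpow {x : ℝ} (hx : 0 < x) (r : ℂ) :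
    HasDerivAt (fun y : ℝ => (y : ℂ) ^ r) (r * (x : ℂ) ^ (r - 1)) x := by
  have h := ((hasDerivAt_id (x : ℂ)).cpow_const (c := r)
    (Complex.ofReal_mem_slitPlane.2 hx)).comp_ofReal
  simpa using! h

/-- `emTerm n s` is the increment on `[n + 1, n + 2]` of a function whose derivative is the third
derivative of `x ^ (-s)` times a bounded cubic polynomial, and that third derivative has size
`x ^ (-re s - 3)`. -/
lemma norm_emTerm_le {n : ℕ} {s : ℂ} {R : ℝ} (h1 : s ≠ 1) (hre : -(3 / 2) ≤ s.re)
    (hR : ‖s‖ ≤ R) :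
    ‖emTerm n s‖ ≤ R * (R + 1) * (R + 2) * ((n + 1 : ℝ) ^ (-(3 / 2) : ℝ)) := by
  set a : ℝ := n + 1 with ha
  have ha1 : 1 ≤ a := by rw [ha]; linarith [n.cast_nonneg (α := ℝ)]
  have hR0 : 0 ≤ R := (norm_nonneg s).trans hR
  -- With `f = x ^ (-s)`, `F` its primitive and `p(t) = (2t³ - 3t² + t) / 12`, this is
  -- `p f'' - p' f' + p'' f - F`. Since `p''' = 1`, its derivative collapses to `p f'''`; the
  -- boundary values `p = 0`, `p' = 1/12`, `p'' = ∓1/2` at `t = 0, 1` give the trapezoidal error.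
  let Φ : ℝ → ℂ := fun x =>
    ((2 * (x - a) ^ 3 - 3 * (x - a) ^ 2 + (x - a)) / 12 : ℝ) * (s * (s + 1) * (x : ℂ) ^ (-s - 2))
    + ((6 * (x - a) ^ 2 - 6 * (x - a) + 1) / 12 : ℝ) * (s * (x : ℂ) ^ (-s - 1))
    + ((2 * (x - a) - 1) / 2 : ℝ) * (x : ℂ) ^ (-s) - (x : ℂ) ^ (1 - s) / (1 - s)
  have hΦ : ∀ x ∈ Set.Icc a (a + 1), HasDerivWithinAt Φ
      (-(((2 * (x - a) ^ 3 - 3 * (x - a) ^ 2 + (x - a)) / 12 : ℝ) *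
        (s * (s + 1) * (s + 2) * (x : ℂ) ^ (-s - 3)))) (Set.Icc a (a + 1)) x := by
    intro x hx
    have hx0 : 0 < x := by linarith [hx.1]
    have h1s : 1 - s ≠ 0 := sub_ne_zero.2 h1.symm
    have hi : HasDerivAt (fun x : ℝ => x - a) 1 x := (hasDerivAt_id x).sub_const a
    have p0 : HasDerivAt (fun x : ℝ => (2 * (x - a) ^ 3 - 3 * (x - a) ^ 2 + (x - a)) / 12)
        ((6 * (x - a) ^ 2 - 6 * (x - a) + 1) / 12) x := by
      convert! ((((hi.pow 3).const_mul 2).sub ((hi.pow 2).const_mul 3)).add hi).div_const 12 using 1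
      push_cast; ring
    have p1 : HasDerivAt (fun x : ℝ => (6 * (x - a) ^ 2 - 6 * (x - a) + 1) / 12)
        ((2 * (x - a) - 1) / 2) x := by
      convert! ((((hi.pow 2).const_mul 6).sub (hi.const_mul 6)).add_const 1).div_const 12 using 1
      push_cast; ring
    have p2 : HasDerivAt (fun x : ℝ => (2 * (x - a) - 1) / 2) 1 x := by
      convert! ((hi.const_mul 2).sub_const 1).div_const 2 using 1
      ring
    have f2 := (hasDerivAt_ofReal_cpow hx0 (-s - 2)).const_mul (s * (s + 1))
    have f1 := (hasDerivAt_ofReal_cpow hx0 (-s - 1)).const_mul s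
    have f0 := hasDerivAt_ofReal_cpow hx0 (-s)
    have F := (hasDerivAt_ofReal_cpow hx0 (1 - s)).div_const (1 - s)
    have h := (((p0.ofReal_comp.mul f2).add (p1.ofReal_comp.mul f1)).add
      (p2.ofReal_comp.mul f0)).sub F
    refine HasDerivAt.hasDerivWithinAt ?_
    convert! h using 1
    have e3 : -s - 2 - 1 = -s - 3 := by ring
    have e2 : -s - 1 - 1 = -s - 2 := by ring
    have e0 : 1 - s - 1 = -s := by ring
    rw [e3, e2, e0, mul_div_cancel_left₀ _ h1s]
    push_cast
    ring
  have hbd : ∀ x ∈ Set.Icc a (a + 1),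
      ‖-(((2 * (x - a) ^ 3 - 3 * (x - a) ^ 2 + (x - a)) / 12 : ℝ) *
        (s * (s + 1) * (s + 2) * (x : ℂ) ^ (-s - 3)))‖
        ≤ R * (R + 1) * (R + 2) * (a ^ (-(3 / 2) : ℝ)) := by
    intro x hx
    have hx0 : 0 < x := by linarith [hx.1]
    have ht0 : 0 ≤ x - a := by linarith [hx.1]
    have ht1 : x - a ≤ 1 := by linarith [hx.2]
    have hp : |(2 * (x - a) ^ 3 - 3 * (x - a) ^ 2 + (x - a)) / 12| ≤ 1 := by
      have h2 := pow_le_one₀ (n := 2) ht0 ht1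
      have h3 := pow_le_one₀ (n := 3) ht0 ht1
      rw [abs_le]
      constructor <;> nlinarith [pow_nonneg ht0 2, pow_nonneg ht0 3]
    have hx3 : ‖(x : ℂ) ^ (-s - 3)‖ ≤ a ^ (-(3 / 2) : ℝ) := by
      rw [Complex.norm_cpow_eq_rpow_re_of_pos hx0]
      calc x ^ (-s - 3).re ≤ x ^ (-(3 / 2) : ℝ) :=
            Real.rpow_le_rpow_of_exponent_le (by linarith [hx.1]) (by simp; linarith)
        _ ≤ a ^ (-(3 / 2) : ℝ) :=
            Real.rpow_le_rpow_of_nonpos (by linarith) hx.1 (by norm_num)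
    have n1 : ‖s + 1‖ ≤ R + 1 := (norm_add_le _ _).trans (by simpa using hR)
    have n2 : ‖s + 2‖ ≤ R + 2 := (norm_add_le _ _).trans (by simpa using hR)
    rw [norm_neg, norm_mul, norm_mul, norm_mul, norm_mul, Complex.norm_real, Real.norm_eq_abs]
    calc _ ≤ 1 * (‖s‖ * ‖s + 1‖ * ‖s + 2‖ * ‖(x : ℂ) ^ (-s - 3)‖) := by gcongr
      _ ≤ _ := by rw [one_mul]; gcongr
  have hmain := (convex_Icc a (a + 1)).norm_image_sub_le_of_norm_hasDerivWithin_le hΦ hbd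
    (Set.left_mem_Icc.2 (by linarith)) (Set.right_mem_Icc.2 (by linarith))
  have hval : Φ (a + 1) - Φ a = emTerm n s := by
    have h2 : (n + 2 : ℝ) = a + 1 := by rw [ha]; ring
    simp only [Φ, emTerm, emCorrection]
    rw [h2, ← ha]
    push_cast
    ring
  rw [hval] at hmain
  simpa using hmain

lemma sum_emTerm (N : ℕ) (s : ℂ) :
    ∑ n ∈ Finset.range N, emTerm n s =
      ∑ n ∈ Finset.range N, ((n + 1 : ℝ) : ℂ) ^ (-s) + emCorrection (N + 1) s
        - emCorrection 1 s := by
  have h := Finset.sum_range_sub (fun n : ℕ => emCorrection (n + 1) s) N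
  simp only [emTerm, Finset.sum_add_distrib]
  rw [add_sub_assoc]
  congr 1
  convert h using 2
  · push_cast; ring_nf
  · simp

lemma tendsto_natCast_add_one_cpow_zero {r : ℂ} (hr : r.re < 0) :
    Tendsto (fun N : ℕ => ((N + 1 : ℝ) : ℂ) ^ r) atTop (𝓝 0) := by
  rw [tendsto_zero_iff_norm_tendsto_zero]
  have h := (tendsto_rpow_neg_atTop (y := -r.re) (by linarith)).comp
    (tendsto_atTop_add_const_right _ (1 : ℝ) (tendsto_natCast_atTop_atTop (R := ℝ)))
  refine h.congr fun N => ?_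
  rw [Complex.norm_cpow_eq_rpow_re_of_pos (by positivity)]
  simp

lemma tendsto_emCorrection {s : ℂ} (hs : 1 < s.re) :
    Tendsto (fun N : ℕ => emCorrection (N + 1) s) atTop (𝓝 0) := by
  have h0 := (tendsto_natCast_add_one_cpow_zero (r := -s) (by simp; linarith)).div_const 2
  have h1 := (tendsto_natCast_add_one_cpow_zero (r := 1 - s) (by simp; linarith)).div_const (1 - s)
  have h2 := ((tendsto_natCast_add_one_cpow_zero (r := -s - 1) (by simp; linarith)).const_mul
    s).div_const 12
  simpa [emCorrection] using (h0.sub h1).add h2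

/-- A bounded convex open region that contains `-1`, meets the half-plane `1 < re s`, and avoids the
pole `s = 1`, because it lies above the diagonal `im s = re s`. On it `emTerm n` is
`O((n + 1) ^ (-3/2))`, uniformly in `s`. -/
def emRegion : Set ℂ := {s | -(3 / 2) < s.re} ∩ {s | s.re < s.im} ∩ Metric.ball 0 5

lemma isOpen_emRegion : IsOpen emRegion :=
  ((isOpen_lt continuous_const Complex.continuous_re).inter
    (isOpen_lt Complex.continuous_re Complex.continuous_im)).inter Metric.isOpen_ball

lemma convex_emRegion : Convex ℝ emRegion := by
  refine ((convex_halfSpace_re_gt _).inter ?_).inter (convex_ball 0 5)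
  intro x hx y hy a b ha hb hab
  change (a • x + b • y).re < (a • x + b • y).im
  change x.re < x.im at hx
  change y.re < y.im at hy
  simp only [Complex.add_re, Complex.add_im, Complex.real_smul, Complex.re_ofReal_mul,
    Complex.im_ofReal_mul]
  rcases ha.eq_or_lt with rfl | ha
  · obtain rfl : b = 1 := by linarith
    simpa using hy
  · nlinarith

lemma ne_one_of_mem_emRegion {s : ℂ} (hs : s ∈ emRegion) : s ≠ 1 := by
  rintro rfl
  have := hs.1.2
  norm_num at this

lemma neg_one_mem_emRegion : (-1 : ℂ) ∈ emRegion := by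
  refine ⟨⟨?_, ?_⟩, ?_⟩ <;> norm_num

lemma summable_const_mul_rpow (C : ℝ) :
    Summable fun n : ℕ => C * ((n + 1 : ℝ) ^ (-(3 / 2) : ℝ)) := by
  refine Summable.mul_left _ ?_
  have := (summable_nat_add_iff 1).2 (Real.summable_nat_rpow.2 (by norm_num : -(3 / 2 : ℝ) < -1))
  simpa using this

lemma norm_emTerm_le_of_mem {s : ℂ} (n : ℕ) (hs : s ∈ emRegion) :
    ‖emTerm n s‖ ≤ 5 * (5 + 1) * (5 + 2) * ((n + 1 : ℝ) ^ (-(3 / 2) : ℝ)) :=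
  norm_emTerm_le (ne_one_of_mem_emRegion hs) hs.1.1.le (mem_ball_zero_iff.1 hs.2).le

lemma hasDerivAt_cpow_exponent {x : ℝ} (hx : 0 < x) {g : ℂ → ℂ} {g' s : ℂ}
    (hg : HasDerivAt g g' s) :
    HasDerivAt (fun z => (x : ℂ) ^ g z) ((x : ℂ) ^ g s * Real.log x * g') s := by
  rw [Complex.ofReal_log hx.le]
  exact hg.const_cpow (Or.inl (by exact_mod_cast hx.ne'))

lemma differentiableAt_emCorrection {x : ℝ} (hx : 0 < x) {s : ℂ} (hs : s ≠ 1) :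
    DifferentiableAt ℂ (emCorrection x) s := by
  have hx' : (x : ℂ) ≠ 0 := by exact_mod_cast hx.ne'
  have : 1 - s ≠ 0 := sub_ne_zero.2 hs.symm
  unfold emCorrection
  fun_prop (disch := first | assumption | simp [hx'])

lemma differentiableAt_emTerm (n : ℕ) {s : ℂ} (hs : s ≠ 1) :
    DifferentiableAt ℂ (emTerm n) s := by
  have hx' : ((n + 1 : ℝ) : ℂ) ≠ 0 := by exact_mod_cast n.succ_ne_zero
  have h1 := differentiableAt_emCorrection (x := n + 1) (by positivity) hs
  have h2 := differentiableAt_emCorrection (x := n + 2) (by positivity) hs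
  unfold emTerm
  exact (((hasDerivAt_neg s).const_cpow (Or.inl hx')).differentiableAt).add (h2.sub h1)

lemma tsum_emTerm_of_one_lt_re {s : ℂ} (hs : 1 < s.re) (hU : s ∈ emRegion) :
    ∑' n, emTerm n s = riemannZeta s - emCorrection 1 s := by
  have hsum : Summable fun n => emTerm n s :=
    Summable.of_norm_bounded (summable_const_mul_rpow _) fun n => norm_emTerm_le_of_mem n hU
  refine tendsto_nhds_unique hsum.hasSum.tendsto_sum_nat ?_
  have hz : HasSum (fun n : ℕ => ((n + 1 : ℝ) : ℂ) ^ (-s)) (riemannZeta s) := by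
    have h := (summable_nat_add_iff 1).2 (Complex.summable_one_div_nat_cpow.2 hs)
    have h' := h.hasSum
    simp only [Nat.cast_add, Nat.cast_one] at h'
    rw [← zeta_eq_tsum_one_div_nat_add_one_cpow hs] at h'
    refine h'.congr_fun fun n => ?_
    rw [Complex.cpow_neg]; simp
  have := (hz.tendsto_sum_nat.add (tendsto_emCorrection hs)).sub_const (emCorrection 1 s)
  rw [add_zero] at this
  exact this.congr fun N => (sum_emTerm N s).symm

/-- The identity theorem extends the evaluation of the Euler–Maclaurin series from the half-plane of
convergence of the Dirichlet series to the whole region. -/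
lemma eqOn_tsum_emTerm :
    Set.EqOn (fun s => ∑' n, emTerm n s) (fun s => riemannZeta s - emCorrection 1 s)
      emRegion := by
  have hF : DifferentiableOn ℂ (fun s => ∑' n, emTerm n s) emRegion :=
    Complex.differentiableOn_tsum_of_summable_norm (summable_const_mul_rpow _)
      (fun n s hs => (differentiableAt_emTerm n
        (ne_one_of_mem_emRegion hs)).differentiableWithinAt)
      isOpen_emRegion fun n s hs => norm_emTerm_le_of_mem n hs
  have hG : DifferentiableOn ℂ (fun s => riemannZeta s - emCorrection 1 s) emRegion :=
    fun s hs => ((differentiableAt_riemannZeta (ne_one_of_mem_emRegion hs)).sub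
      (differentiableAt_emCorrection one_pos
        (ne_one_of_mem_emRegion hs))).differentiableWithinAt
  -- a point of the region at which the Dirichlet series of `ζ` converges
  have hmem : (2 + 3 * Complex.I : ℂ) ∈ emRegion := by
    refine ⟨⟨?_, ?_⟩, ?_⟩
    · simp; norm_num
    · simp; norm_num
    · rw [mem_ball_zero_iff, ← sq_lt_sq₀ (norm_nonneg _) (by norm_num), Complex.sq_norm,
        Complex.normSq_apply]
      simp; norm_num
  refine (hF.analyticOnNhd isOpen_emRegion).eqOn_of_preconnected_of_eventuallyEq
    (hG.analyticOnNhd isOpen_emRegion) convex_emRegion.isPreconnected hmem ?_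
  filter_upwards [isOpen_emRegion.mem_nhds hmem,
    (isOpen_lt continuous_const Complex.continuous_re).mem_nhds
      (show (1 : ℝ) < (2 + 3 * Complex.I : ℂ).re by simp)] with s hs hs'
  exact tsum_emTerm_of_one_lt_re hs' hs

/-! ### The Glaisher–Kinkelin constant and `ζ'(-1)` -/

/-- The derivative of `emCorrection x` at `s = -1`, as a real number. -/
noncomputable def emCorrectionDeriv (x : ℝ) : ℝ :=
  -(x * Real.log x / 2) + (x ^ 2 * Real.log x / 2 - x ^ 2 / 4) + (1 + Real.log x) / 12

lemma hasDerivAt_emCorrection_neg_one {x : ℝ} (hx : 0 < x) :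
    HasDerivAt (emCorrection x) (emCorrectionDeriv x : ℂ) (-1) := by
  have h0 := (hasDerivAt_cpow_exponent hx (hasDerivAt_neg (-1 : ℂ))).div_const 2
  have hi : HasDerivAt (fun s : ℂ => 1 - s) (-1) (-1) := (hasDerivAt_id (-1 : ℂ)).const_sub 1
  have h1 := (hasDerivAt_cpow_exponent hx hi).div hi (by norm_num)
  have h2 := ((hasDerivAt_id (-1 : ℂ)).mul (hasDerivAt_cpow_exponent hx
    ((hasDerivAt_neg (-1 : ℂ)).sub_const 1))).div_const 12
  convert! (h0.sub h1).add h2 using 1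
  have e : (1 : ℂ) - -1 = 2 := by norm_num
  simp only [emCorrectionDeriv, e, neg_neg, sub_self, Complex.cpow_one, Complex.cpow_zero,
    Complex.cpow_ofNat, id]
  push_cast
  ring

lemma hasDerivAt_emTerm_neg_one (n : ℕ) :
    HasDerivAt (emTerm n) ((-((n + 1 : ℝ) * Real.log (n + 1))
      + (emCorrectionDeriv (n + 2) - emCorrectionDeriv (n + 1)) : ℝ) : ℂ) (-1) := by
  have hx : (0 : ℝ) < n + 1 := by positivity
  have h0 := hasDerivAt_cpow_exponent hx (hasDerivAt_neg (-1 : ℂ))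
  have h1 := hasDerivAt_emCorrection_neg_one hx
  have h2 := hasDerivAt_emCorrection_neg_one (x := n + 2) (by positivity)
  convert! h0.add (h2.sub h1) using 1
  simp only [neg_neg, Complex.cpow_one]
  push_cast
  ring

lemma hasSum_deriv_emTerm_neg_one :
    HasSum (fun n : ℕ => -((n + 1 : ℝ) * Real.log (n + 1))
      + (emCorrectionDeriv (n + 2) - emCorrectionDeriv (n + 1)))
      ((deriv riemannZeta (-1)).re - emCorrectionDeriv 1) := by
  have h := Complex.hasSum_deriv_of_summable_norm (summable_const_mul_rpow _)
    (fun n s hs => (differentiableAt_emTerm n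
      (ne_one_of_mem_emRegion hs)).differentiableWithinAt)
    isOpen_emRegion (fun n s hs => norm_emTerm_le_of_mem n hs) neg_one_mem_emRegion
  have hev : (fun s => ∑' n, emTerm n s) =ᶠ[𝓝 (-1)]
      (fun s => riemannZeta s - emCorrection 1 s) :=
    eqOn_tsum_emTerm.eventuallyEq_of_mem (isOpen_emRegion.mem_nhds neg_one_mem_emRegion)
  have hd : HasDerivAt (fun s => riemannZeta s - emCorrection 1 s)
      (deriv riemannZeta (-1) - (emCorrectionDeriv 1 : ℂ)) (-1) :=
    (differentiableAt_riemannZeta (by norm_num)).hasDerivAt.sub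
      (hasDerivAt_emCorrection_neg_one one_pos)
  rw [hev.deriv_eq, hd.deriv] at h
  simp only [(hasDerivAt_emTerm_neg_one _).deriv] at h
  simpa using! Complex.hasSum_re h

lemma hyperfactorial_pos (N : ℕ) : 0 < hyperfactorial N :=
  Finset.prod_pos fun k hk => pow_pos (Finset.mem_Icc.1 hk).1 k

lemma log_hyperfactorial (N : ℕ) :
    Real.log (hyperfactorial N) = ∑ n ∈ Finset.range N, (n + 1 : ℝ) * Real.log (n + 1) := by
  induction N with
  | zero => simp [hyperfactorial]
  | succ N ih =>
    have hH : (hyperfactorial N : ℝ) ≠ 0 := by exact_mod_cast (hyperfactorial_pos N).ne'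
    have hs : hyperfactorial (N + 1) = hyperfactorial N * (N + 1) ^ (N + 1) :=
      Finset.prod_Icc_succ_top (by omega) _
    rw [hs, Finset.sum_range_succ, ← ih]
    push_cast
    rw [Real.log_mul hH (by positivity), Real.log_pow]
    push_cast
    ring

/-- The logarithm of `glaisherKinkelinSeq` is, up to sign and the constant `1 / 4`, a partial sum of
the differentiated Euler–Maclaurin series. -/
lemma glaisherKinkelinSeq_succ (N : ℕ) :
    glaisherKinkelinSeq (N + 1) = Real.exp (1 / 4 -
      ∑ n ∈ Finset.range N, (-((n + 1 : ℝ) * Real.log (n + 1))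
        + (emCorrectionDeriv (n + 2) - emCorrectionDeriv (n + 1)))) := by
  have hpos : (0 : ℝ) < N + 1 := by positivity
  have hH : (0 : ℝ) < hyperfactorial (N + 1) := by exact_mod_cast hyperfactorial_pos _
  have htel := Finset.sum_range_sub (fun n : ℕ => emCorrectionDeriv (n + 1)) N
  have htel' : ∑ n ∈ Finset.range N, (emCorrectionDeriv (n + 2) - emCorrectionDeriv (n + 1)) =
      emCorrectionDeriv (N + 1) - emCorrectionDeriv 1 := by
    convert htel using 2
    · push_cast; ring_nf
    · simp
  rw [Finset.sum_add_distrib, htel', Finset.sum_neg_distrib, glaisherKinkelinSeq,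
    ← Real.exp_log hH, log_hyperfactorial, Finset.sum_range_succ, Nat.cast_add_one,
    Real.rpow_def_of_pos hpos, ← Real.exp_add, ← Real.exp_sub]
  congr 1
  simp only [emCorrectionDeriv, Real.log_one]
  ring

/-- The limit exists and `log A = 1/12 - ζ'(-1)`. -/
lemma tendsto_glaisherKinkelinSeq :
    Tendsto glaisherKinkelinSeq atTop
      (𝓝 (Real.exp (1 / 12 - (deriv riemannZeta (-1)).re))) := by
  rw [← tendsto_add_atTop_iff_nat 1]
  simp only [glaisherKinkelinSeq_succ]
  refine (Real.continuous_exp.tendsto _).comp ?_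
  convert! hasSum_deriv_emTerm_neg_one.tendsto_sum_nat.const_sub (1 / 4) using 2
  simp only [emCorrectionDeriv, Real.log_one]
  ring

/-! ### From `ζ'(-1)` to `ζ'(2)` -/

lemma summable_log_div_sq : Summable fun n : ℕ => Real.log n / (n : ℝ) ^ 2 := by
  have h := LSeriesSummable_logMul_of_lt_re (f := 1) (s := 2)
    (by rw [LSeries.abscissaOfAbsConv_one]; exact_mod_cast show (1 : ℝ) < (2 : ℂ).re by simp)
  rw [← Complex.summable_ofReal]
  refine Summable.congr h fun n => ?_
  rcases eq_or_ne n 0 with rfl | hn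
  · simp
  · simp [LSeries.term_of_ne_zero hn, LSeries.logMul]

lemma deriv_riemannZeta_two :
    deriv riemannZeta 2 = -((∑' n : ℕ, Real.log n / (n : ℝ) ^ 2 : ℝ) : ℂ) := by
  have hev : riemannZeta =ᶠ[𝓝 2] LSeries 1 := by
    filter_upwards [(isOpen_lt continuous_const Complex.continuous_re).mem_nhds
      (show (1 : ℝ) < (2 : ℂ).re by simp)] with s hs
    exact (LSeries_one_eq_riemannZeta hs).symm
  rw [hev.deriv_eq, LSeries_deriv (by
      rw [LSeries.abscissaOfAbsConv_one]
      exact_mod_cast show (1 : ℝ) < (2 : ℂ).re by simp),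
    Complex.ofReal_tsum, LSeries]
  congr 2
  ext n
  rcases eq_or_ne n 0 with rfl | hn
  · simp
  · simp [LSeries.term_of_ne_zero hn, LSeries.logMul]

/-- This is the derivative of the functional equation at `s = 2`. The cosine factor contributes
nothing, since its derivative `-(π/2) sin π` vanishes there. -/
lemma deriv_riemannZeta_neg_one :
    deriv riemannZeta (-1) =
      (((1 - Real.eulerMascheroniConstant - Real.log (2 * Real.pi)) / 12
        - (∑' n : ℕ, Real.log n / (n : ℝ) ^ 2) / (2 * Real.pi ^ 2) : ℝ) : ℂ) := by
  have hπ : (Real.pi : ℂ) ≠ 0 := by exact_mod_cast Real.pi_ne_zero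
  have h2π : (2 * Real.pi : ℂ) ≠ 0 := mul_ne_zero two_ne_zero hπ
  have hpos : (0 : ℝ) < 2 * Real.pi := by positivity
  have hl : HasDerivAt (fun s : ℂ => riemannZeta (1 - s)) (-deriv riemannZeta (-1)) 2 := by
    have hz : HasDerivAt riemannZeta (deriv riemannZeta (-1)) (1 - 2) := by
      have := (differentiableAt_riemannZeta (s := -1) (by norm_num)).hasDerivAt
      convert! this using 1; norm_num
    simpa using! hz.comp (2 : ℂ) ((hasDerivAt_id (2 : ℂ)).const_sub 1)
  have hpow : HasDerivAt (fun s : ℂ => 2 * (2 * Real.pi : ℂ) ^ (-s))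
      (2 * ((2 * Real.pi : ℂ) ^ (-2 : ℂ) * Complex.log (2 * Real.pi) * (-1))) 2 :=
    ((hasDerivAt_neg (2 : ℂ)).const_cpow (Or.inl h2π)).const_mul 2
  have hG : HasDerivAt Complex.Gamma (1 - Real.eulerMascheroniConstant) 2 := by
    have := Complex.hasDerivAt_Gamma_nat 1
    convert! this using 1
    · simp; ring
    · norm_num
  have hcos : HasDerivAt (fun s : ℂ => Complex.cos (Real.pi * s / 2)) 0 2 := by
    have := (((hasDerivAt_id (2 : ℂ)).const_mul (Real.pi : ℂ)).div_const 2).ccos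
    convert! this using 1
    simp
  have hz2 := (differentiableAt_riemannZeta (s := 2) (by norm_num)).hasDerivAt
  have hr := ((hpow.mul hG).mul hcos).mul hz2
  have hev : (fun s : ℂ => riemannZeta (1 - s)) =ᶠ[𝓝 2]
      (fun s => 2 * (2 * Real.pi : ℂ) ^ (-s) * Complex.Gamma s *
        Complex.cos (Real.pi * s / 2) * riemannZeta s) := by
    filter_upwards [(isOpen_lt continuous_const Complex.continuous_re).mem_nhds
      (show (1 : ℝ) < (2 : ℂ).re by simp)] with s hs
    change 1 < s.re at hs
    refine riemannZeta_one_sub (fun n hn => ?_) (fun h => ?_)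
    · rw [hn] at hs
      simp at hs
      linarith [n.cast_nonneg (α := ℝ)]
    · simp [h] at hs
  have key := hl.unique (hr.congr_of_eventuallyEq hev)
  have hc : Complex.cos (Real.pi * 2 / 2) = -1 := by simp
  have hg2 : Complex.Gamma 2 = 1 := by
    simp
  have hp2 : (2 * Real.pi : ℂ) ^ (-2 : ℂ) = 1 / (4 * (Real.pi : ℂ) ^ 2) := by
    rw [Complex.cpow_neg]
    norm_num
    ring
  have hlog : Complex.log (2 * Real.pi) = (Real.log (2 * Real.pi) : ℂ) := by
    rw [Complex.ofReal_log hpos.le]; push_cast; rfl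
  simp only [Pi.mul_apply] at key
  rw [hc, hg2, hp2, hlog, deriv_riemannZeta_two, riemannZeta_two] at key
  rw [← neg_inj, key]
  generalize (∑' n : ℕ, Real.log n / (n : ℝ) ^ 2) = S
  push_cast
  field_simp
  ring

/-! ### The product over blocks -/

lemma wallisBlock_eq_exp {k : ℕ} (hk : 1 ≤ k) :
    wallisBlock k = Real.exp (2 * (Real.log (3 * k : ℕ) / ((3 * k : ℕ) : ℝ) ^ 2)
      - Real.log (3 * k - 1 : ℕ) / ((3 * k - 1 : ℕ) : ℝ) ^ 2
      - Real.log (3 * k + 1 : ℕ) / ((3 * k + 1 : ℕ) : ℝ) ^ 2) := by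
  have hk' : (1 : ℝ) ≤ k := by exact_mod_cast hk
  rw [wallisBlock, Nat.cast_sub (by omega)]
  push_cast
  rw [Real.rpow_def_of_pos (by positivity), Real.rpow_def_of_pos (by linarith),
    Real.rpow_def_of_pos (by positivity), ← Real.exp_add, ← Real.exp_add, ← Real.exp_sub]
  congr 1
  ring

/-- Each block is `3 a(3k)` minus the sum of `a` over the three consecutive indices
`3k - 1, 3k, 3k + 1`. -/
lemma sum_Icc_three_mul (a : ℕ → ℝ) (h1 : a 1 = 0) (h0 : a 0 = 0) (N : ℕ) :
    ∑ k ∈ Finset.Icc 1 N, (2 * a (3 * k) - a (3 * k - 1) - a (3 * k + 1)) =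
      3 * ∑ k ∈ Finset.range (N + 1), a (3 * k) - ∑ n ∈ Finset.range (3 * N + 2), a n := by
  induction N with
  | zero => simp [Finset.sum_range_succ, h0, h1]
  | succ N ih =>
    rw [Finset.sum_Icc_succ_top (by omega), ih, Finset.sum_range_succ _ (N + 1),
      show 3 * (N + 1) + 2 = 3 * N + 2 + 1 + 1 + 1 by ring,
      Finset.sum_range_succ _ (3 * N + 2 + 1 + 1), Finset.sum_range_succ _ (3 * N + 2 + 1),
      Finset.sum_range_succ _ (3 * N + 2),
      show 3 * (N + 1) - 1 = 3 * N + 2 by omega, show 3 * (N + 1) = 3 * N + 2 + 1 by ring]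
    ring

lemma hasSum_log_three_mul :
    HasSum (fun k : ℕ => Real.log (3 * k : ℕ) / ((3 * k : ℕ) : ℝ) ^ 2)
      ((Real.log 3 * (Real.pi ^ 2 / 6) + ∑' n : ℕ, Real.log n / (n : ℝ) ^ 2) / 9) := by
  have h := ((hasSum_zeta_two.mul_left (Real.log 3)).add summable_log_div_sq.hasSum).div_const 9
  refine h.congr_fun fun k => ?_
  rcases eq_or_ne k 0 with rfl | hk
  · simp
  · have : (k : ℝ) ≠ 0 := by exact_mod_cast hk
    push_cast
    rw [Real.log_mul (by norm_num) this]
    field_simp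
    ring

/-- The value of the product in terms of `∑ log n / n² = -ζ'(2)`. -/
lemma tendsto_prod_wallisBlock :
    Tendsto (fun N : ℕ => ∏ k ∈ Finset.Icc 1 N, wallisBlock k) atTop
      (𝓝 (Real.exp (Real.pi ^ 2 / 18 * Real.log 3
        - 2 / 3 * ∑' n : ℕ, Real.log n / (n : ℝ) ^ 2))) := by
  set a : ℕ → ℝ := fun n => Real.log n / (n : ℝ) ^ 2 with ha
  have hprod : ∀ N : ℕ, ∏ k ∈ Finset.Icc 1 N, wallisBlock k =
      Real.exp (3 * ∑ k ∈ Finset.range (N + 1), a (3 * k)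
        - ∑ n ∈ Finset.range (3 * N + 2), a n) := by
    intro N
    rw [← sum_Icc_three_mul a (by simp [ha]) (by simp [ha]), Real.exp_sum]
    exact Finset.prod_congr rfl fun k hk => wallisBlock_eq_exp (Finset.mem_Icc.1 hk).1
  simp only [hprod]
  refine (Real.continuous_exp.tendsto _).comp ?_
  have h1 := (hasSum_log_three_mul.tendsto_sum_nat.comp (tendsto_add_atTop_nat 1)).const_mul 3
  have h2 := summable_log_div_sq.hasSum.tendsto_sum_nat.comp
    (tendsto_atTop_mono (fun N : ℕ => (by simp only [id]; omega : id N ≤ 3 * N + 2)) tendsto_id)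
  convert! h1.sub h2 using 2
  ring

/-! ### The closed form -/

lemma glaisherKinkelin_eq_exp :
    glaisherKinkelin = Real.exp ((Real.eulerMascheroniConstant + Real.log (2 * Real.pi)) / 12
      + (∑' n : ℕ, Real.log n / (n : ℝ) ^ 2) / (2 * Real.pi ^ 2)) := by
  rw [glaisherKinkelin, tendsto_glaisherKinkelinSeq.limUnder_eq, deriv_riemannZeta_neg_one,
    Complex.ofReal_re]
  congr 1
  ring

theorem mainTheorem8 :
    -- the limit defining the Glaisher–Kinkelin constant exists and is positive
    Tendsto glaisherKinkelinSeq atTop (𝓝 glaisherKinkelin) ∧ 0 < glaisherKinkelin ∧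
    -- the infinite product converges to the stated value
    Tendsto (fun N : ℕ => ∏ k ∈ Finset.Icc 1 N, wallisBlock k) atTop
      (𝓝 ((3 * (2 * Real.pi * Real.exp Real.eulerMascheroniConstant / glaisherKinkelin ^ 12) ^ 2)
        ^ (Real.pi ^ 2 / 18))) := by
  refine ⟨?_, ?_, ?_⟩
  · exact tendsto_nhds_limUnder ⟨_, tendsto_glaisherKinkelinSeq⟩
  · rw [glaisherKinkelin_eq_exp]
    exact Real.exp_pos _
  · convert tendsto_prod_wallisBlock using 2
    have h2π : (0 : ℝ) < 2 * Real.pi := by positivity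
    have hA : 0 < glaisherKinkelin := by rw [glaisherKinkelin_eq_exp]; exact Real.exp_pos _
    rw [Real.rpow_def_of_pos (by positivity)]
    congr 1
    rw [Real.log_mul (by norm_num) (by positivity), Real.log_pow,
      Real.log_div (by positivity) (by positivity), Real.log_mul h2π.ne' (Real.exp_ne_zero _),
      Real.log_exp, Real.log_pow, glaisherKinkelin_eq_exp, Real.log_exp]
    generalize (∑' n : ℕ, Real.log n / (n : ℝ) ^ 2) = S
    have := Real.pi_ne_zero
    push_cast
    field_simp
    ring
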